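/- **Conventions.** All functions are real-valued, smooth ($C^\infty$), and defined for all real values of their variables $x,p_0,p_1,\dots$. A function is said to be of order $k$ ($k\ge 0$) if it depends only on $(x,p_0,\dots,p_k)$. Write $\partial_k=\partial/\partial p_k$, $$\int^{p_k}\!F=\int_0^{p_k}F|_{p_k=t}\,dt,\qquad \int^{p_k}\!\!\!\int F=\int_0^{p_k}\!\!\int_0^{t}F|_{p_k=s}\,ds\,dt,$$ $$D_m=\partial_x+\sum_{j=0}^{m-1}p_{j+1}\partial_j,\qquad E_m^n=\sum_{k=0}^{n}(-1)^kD_m^k\,\partial_k ,$$ where $D_m^k$ is the $k$-th power of $D_m$, while in $E_m^n$ the superscript is only an index. **Theorem D.** Let $m\ge n\ge 3$. (1) Suppose that $f_{2n-1}$ and $\rho_{2n-1}>0$ of order $2n-1$ and $L_m$ of order $m$ satisfy $$\rho_{2n-1}\,(p_{2n}-f_{2n-1})=E_{2m}^m L_m \qquad (*)$$ for all values of the variables. Then there are functions $R_n$ of order $n$, $f_k$ of order $k$ ($0\le k\le n-1$) and $N_{m-1}$ of order $m-1$ such that $$f_{2n-1}=n\,D_{n+1}R_n\cdot p_{2n-1}-e^{R_n}\Big[(-1)^nE_{2n-2}^n\int^{p_n}\!\!\!\int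 e^{-R_n}+\sum_{\ell=1}^{n-1}\Big(f_\ell\,p_{2\ell}+(-1)^\ell E_{2\ell-1}^{\ell}\int^{p_\ell}\!\!\!\int f_\ell\Big)+f_0\Big],$$ $$\rho_{2n-1}=e^{-R_n},$$ $$L_m=(-1)^n\int^{p_n}\!\!\!\int e^{-R_n}+\sum_{\ell=1}^{n-1}(-1)^\ell\int^{p_\ell}\!\!\!\int f_\ell+\int^{p_0}\!f_0+D_mN_{m-1}.$$ (2) Conversely, for any $R_n$, $(f_k)_{0\le k\le n-1}$ and $N_{m-1}$ of the indicated orders, the functions $f_{2n-1}$, $\rho_{2n-1}=e^{-R_n}$ and $L_m$ defined by these formulas are smooth of orders $2n-1$, $n$ and $m$ respectively, $\rho_{2n-1}$ is positive, and $(*)$ holds. (3) Consequently, degenerate Lagrangians of higher order produce no new variational equations: for given $f_{2n-1}$ and $\rho_{2n-1}>0$ of order $2n-1$, equation $(*)$ has a solution $L_m$ of order $m$ if and only if $\rho_{2n-1}$ is of order $n$ and $\rho_{2n-1}(p_{2n}-f_{2n-1})=E_{2n}^nL_n$ has a solution $L_n$ of order $n$. -/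

import Mathlib

open scoped ContDiff

namespace MultiplierProblem

/-- Real functions of the variables `x, p₀, p₁, p₂, …`. Only functions of finitely many of the
`p_k` are used below, see `HasOrder`. -/
abbrev JetFun : Type := ℝ → (ℕ → ℝ) → ℝ

/-- `HasOrder k F`: `F` is a smooth function of the variables `(x, p₀, …, p_k)` alone. -/
def HasOrder (k : ℕ) (F : JetFun) : Prop :=
  ∃ G : ℝ × (Fin (k + 1) → ℝ) → ℝ, ContDiff ℝ ∞ G ∧
    ∀ (x : ℝ) (p : ℕ → ℝ), F x p = G (x, fun i => p i)

/-- The partial derivative `∂_x`. -/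
noncomputable def dx (F : JetFun) : JetFun :=
  fun x p => deriv (fun t => F t p) x

/-- The partial derivative `∂_k` with respect to `p_k`. -/
noncomputable def dp (k : ℕ) (F : JetFun) : JetFun :=
  fun x p => deriv (fun t => F x (Function.update p k t)) (p k)

/-- The anti-derivative `∫^{p_k} F`, based at `p_k = 0`. -/
noncomputable def int1 (k : ℕ) (F : JetFun) : JetFun :=
  fun x p => ∫ t in (0 : ℝ)..p k, F x (Function.update p k t)

/-- The second anti-derivative `∫^{p_k}∫ F`, based at `p_k = 0`. -/
noncomputable def int2 (k : ℕ) (F : JetFun) : JetFun :=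
  fun x p => ∫ t in (0 : ℝ)..p k, ∫ s in (0 : ℝ)..t, F x (Function.update p k s)

/-- The truncated total differential operator
`D_m = ∂_x + p₁ ∂₀ + p₂ ∂₁ + ⋯ + p_m ∂_{m-1}`. -/
noncomputable def D (m : ℕ) (F : JetFun) : JetFun :=
  fun x p => dx F x p + ∑ j ∈ Finset.range m, p (j + 1) * dp j F x p

/-- The `m`-th order Euler-Lagrange operator with `n + 1` terms,
`E_m^n = ∑_{k=0}^n (-1)^k D_m^k ∂_k` (here `D_m^k` is the `k`-th iterate). -/
noncomputable def E (m n : ℕ) (F : JetFun) : JetFun :=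
  fun x p => ∑ k ∈ Finset.range (n + 1), (-1 : ℝ) ^ k * (D m)^[k] (dp k F) x p

/-- The equation `ρ (p_{2n} - f) = E_{2m}^m L`, for all values of the variables. -/
def Solves (n m : ℕ) (ρ f L : JetFun) : Prop :=
  ∀ (x : ℝ) (p : ℕ → ℝ), ρ x p * (p (2 * n) - f x p) = E (2 * m) m L x p

/-- `e^{-R}`. -/
noncomputable def expNeg (R : JetFun) : JetFun :=
  fun x p => Real.exp (-(R x p))

/-- The function
`n D_{n+1}R · p_{2n-1} - e^R [(-1)^n E_{2n-2}^n ∫^{p_n}∫ e^{-R}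
  + ∑_{l=1}^{n-1} (c_l p_{2l} + (-1)^l E_{2l-1}^l ∫^{p_l}∫ c_l) + c₀]`. -/
noncomputable def formF (n : ℕ) (R : JetFun) (c : ℕ → JetFun) : JetFun :=
  fun x p =>
    n * D (n + 1) R x p * p (2 * n - 1)
      - Real.exp (R x p) *
        ((-1 : ℝ) ^ n * E (2 * n - 2) n (int2 n (expNeg R)) x p
          + ∑ l ∈ Finset.Icc 1 (n - 1),
              (c l x p * p (2 * l) + (-1 : ℝ) ^ l * E (2 * l - 1) l (int2 l (c l)) x p)
          + c 0 x p)

/-- The function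
`(-1)^n ∫^{p_n}∫ e^{-R} + ∑_{l=1}^{n-1} (-1)^l ∫^{p_l}∫ c_l + ∫^{p₀} c₀ + D_m N`. -/
noncomputable def formL (n m : ℕ) (R : JetFun) (c : ℕ → JetFun) (N : JetFun) : JetFun :=
  fun x p =>
    (-1 : ℝ) ^ n * int2 n (expNeg R) x p
      + ∑ l ∈ Finset.Icc 1 (n - 1), (-1 : ℝ) ^ l * int2 l (c l) x p
      + int1 0 (c 0) x p
      + D m N x p

end MultiplierProblem

open MultiplierProblem

/-!
Write `D` for the untruncated total derivative. Everything rests on the commutation rule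
`∂_{k+1} D = D ∂_{k+1} + ∂_k` (`IsSmooth.dp_succ_D`).

*Leading coefficients.* For `F` of order `r` and `k ≥ 1` it shows that `D^k F` is affine in
`p_{r+k}` with coefficient `∂_r F` (`HasOrder.dp_iterate_D`), so that the coefficient of `p_{2r}` in
the Euler–Lagrange expression of a Lagrangian `L` of order `r ≥ 1` is `(-1)^r ∂_r² L`
(`HasOrder.dp_E`). It also makes the Euler–Lagrange operator annihilate total derivatives
(`HasOrder.E_D`).

*Reduction of the Lagrangian.* If `∂_{k+1}² L = 0` for `L` of order `k + 1`, then `A = ∂_{k+1} L`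
has order `k`, and subtracting `D ∫^{p_k} A` from `L` leaves a Lagrangian of order `k`
(`HasOrder.exists_eq_add_D`). Now let `E L = ρ (p_{2n} - f)` with `L` of order `m`. For
`k = m, m - 1, …, n + 1` the right-hand side does not contain `p_{2k}`, so `L` can be lowered to
order `n` (`HasOrder.exists_eq_add_D_of_E`). At order `n` the coefficient of `p_{2n}` gives
`ρ = (-1)^n ∂_n² L`, which has order `n` and defines `R = -log ρ`. After subtracting
`(-1)^n ∫^{p_n}∫ ρ` the Lagrangian is again affine in `p_n`; continuing in the same way down to
order `0` produces the functions `c_l` (`HasOrder.exists_normal_form`).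

*The equation of the normal form.* On functions of order at most `M` the truncated operator
`D_M` is the total derivative with `p_{M+1}` set to `0`, so shortening the truncation splits off
the terms with the highest variables. For `∫^{p_l}∫ c_l` this is `p_{2l} c_l`
(`HasOrder.E_eq_top`); for `∫^{p_n}∫ e^{-R}` the terms with `p_{2n}` and `p_{2n-1}` are both split
off (`HasOrder.E_eq_top_sub`). Adding up shows that the normal form solves the equation with the
stated `f` (`E_formL`), and since `ρ > 0` the equation determines `f`.
-/

namespace MultiplierProblem

/-! ### Integrals depending on parameters -/

section ParametricIntegral

variable {V : Type*} [NormedAddCommGroup V] [NormedSpace ℝ V] [FiniteDimensional ℝ V]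

/-- Differentiation under the integral sign for a smooth integrand on a compact interval. -/
theorem hasFDerivAt_integral_of_contDiff {G : V × ℝ → ℝ} (hG : ContDiff ℝ ∞ G) (y : V) :
    HasFDerivAt (fun y => ∫ t in (0 : ℝ)..1, G (y, t))
      (∫ t in (0 : ℝ)..1, (fderiv ℝ G (y, t)).comp (ContinuousLinearMap.inl ℝ V ℝ)) y := by
  have hcont : Continuous fun z : V × ℝ =>
      (fderiv ℝ G z).comp (ContinuousLinearMap.inl ℝ V ℝ) :=
    (hG.continuous_fderiv (by simp)).clm_comp continuous_const
  obtain ⟨C, hC⟩ := ((isCompact_closedBall y 1).prod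
    (isCompact_Icc (a := (0 : ℝ)) (b := 1))).exists_bound_of_continuousOn hcont.continuousOn
  refine intervalIntegral.hasFDerivAt_integral_of_dominated_of_fderiv_le (bound := fun _ => C)
    (F' := fun y t => (fderiv ℝ G (y, t)).comp (ContinuousLinearMap.inl ℝ V ℝ))
    (Metric.closedBall_mem_nhds y one_pos) ?_ ?_ ?_ ?_ (by simp) ?_
  · exact Filter.Eventually.of_forall fun z =>
      (hG.continuous.comp (by fun_prop : Continuous fun t : ℝ => (z, t))).aestronglyMeasurable
  · exact (hG.continuous.comp
      (by fun_prop : Continuous fun t : ℝ => (y, t))).intervalIntegrable _ _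
  · exact (hcont.comp (by fun_prop : Continuous fun t : ℝ => (y, t))).aestronglyMeasurable
  · refine Filter.Eventually.of_forall fun t ht z hz => hC (z, t) ⟨hz, ?_⟩
    rw [Set.uIoc_of_le zero_le_one] at ht
    exact ⟨ht.1.le, ht.2⟩
  · refine Filter.Eventually.of_forall fun t _ z _ => ?_
    exact ((hG.differentiable (by simp)) (z, t)).hasFDerivAt.comp z (hasFDerivAt_prodMk_left z t)

theorem contDiff_integral_zero_one {G : V × ℝ → ℝ} (hG : ContDiff ℝ ∞ G) :
    ContDiff ℝ ∞ fun y => ∫ t in (0 : ℝ)..1, G (y, t) := by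
  rw [contDiff_infty]
  intro k
  induction k generalizing G with
  | zero =>
    exact contDiff_zero.2 (continuous_iff_continuousAt.2 fun y =>
      (hasFDerivAt_integral_of_contDiff hG y).continuousAt)
  | succ k ih =>
    push_cast
    rw [contDiff_succ_iff_fderiv_apply]
    refine ⟨fun y => (hasFDerivAt_integral_of_contDiff hG y).differentiableAt, by simp,
      fun v => ?_⟩
    have hcont : Continuous fun z : V × ℝ =>
        (fderiv ℝ G z).comp (ContinuousLinearMap.inl ℝ V ℝ) :=
      (hG.continuous_fderiv (by simp)).clm_comp continuous_const
    have key : (fun y => fderiv ℝ (fun y => ∫ t in (0 : ℝ)..1, G (y, t)) y v) =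
        fun y => ∫ t in (0 : ℝ)..1, (fun z => fderiv ℝ G z (v, 0)) (y, t) := by
      funext y
      rw [(hasFDerivAt_integral_of_contDiff hG y).fderiv,
        ContinuousLinearMap.intervalIntegral_apply]
      · simp
      · exact (hcont.comp (by fun_prop : Continuous fun t : ℝ => (y, t))).intervalIntegrable _ _
    rw [key]
    exact ih (ContDiff.clm_apply (hG.fderiv_right (by simp)) contDiff_const)

end ParametricIntegral

/-! ### Smooth functions of finite order -/

section FiniteOrder

/-- `F` is a smooth function of finitely many of the variables `x, p₀, p₁, …`. -/
def IsSmooth (F : JetFun) : Prop := ∃ k, HasOrder k F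

/-- The coordinate function `p_k`. -/
def coord (k : ℕ) : JetFun := fun _ p => p k

variable {F F₁ F₂ : JetFun} {k l : ℕ}

theorem HasOrder.isSmooth (h : HasOrder k F) : IsSmooth F := ⟨k, h⟩

theorem HasOrder.mono (h : HasOrder k F) (hkl : k ≤ l) : HasOrder l F := by
  obtain ⟨G, hG, hF⟩ := h
  refine ⟨fun z => G (z.1, fun i => z.2 (Fin.castLE (by omega) i)), hG.comp ?_, fun x p => hF x p⟩
  fun_prop

theorem HasOrder.add (h₁ : HasOrder k F₁) (h₂ : HasOrder k F₂) : HasOrder k (F₁ + F₂) := by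
  obtain ⟨G₁, hG₁, h₁⟩ := h₁
  obtain ⟨G₂, hG₂, h₂⟩ := h₂
  exact ⟨fun z => G₁ z + G₂ z, hG₁.add hG₂, fun x p => by simp [h₁, h₂]⟩

theorem HasOrder.mul (h₁ : HasOrder k F₁) (h₂ : HasOrder k F₂) : HasOrder k (F₁ * F₂) := by
  obtain ⟨G₁, hG₁, h₁⟩ := h₁
  obtain ⟨G₂, hG₂, h₂⟩ := h₂
  exact ⟨fun z => G₁ z * G₂ z, hG₁.mul hG₂, fun x p => by simp [h₁, h₂]⟩

theorem HasOrder.comp {φ : ℝ → ℝ} (h : HasOrder k F) (hφ : ∀ x p, ContDiffAt ℝ ∞ φ (F x p)) :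
    HasOrder k fun x p => φ (F x p) := by
  obtain ⟨G, hG, hF⟩ := h
  refine ⟨fun z => φ (G z), ?_, fun x p => by simp [hF]⟩
  refine contDiff_iff_contDiffAt.2 fun z => ContDiffAt.comp z ?_ hG.contDiffAt
  -- Every point of the finite-dimensional space comes from a sequence, extended by zero.
  convert hφ z.1 (fun j => if hj : j < k + 1 then z.2 ⟨j, hj⟩ else 0)
  rw [hF]
  simp [show ∀ i : Fin (k + 1), (i : ℕ) ≤ k from fun i => by omega]

theorem hasOrder_const (a : ℝ) : HasOrder k fun _ _ => a :=
  ⟨fun _ => a, contDiff_const, fun _ _ => rfl⟩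

theorem HasOrder.smul (h : HasOrder k F) (a : ℝ) : HasOrder k (a • F) :=
  (hasOrder_const a).mul h

theorem HasOrder.sub (h₁ : HasOrder k F₁) (h₂ : HasOrder k F₂) : HasOrder k (F₁ - F₂) := by
  convert h₁.add (h₂.smul (-1)) using 1
  simp [sub_eq_add_neg]

theorem hasOrder_zero : HasOrder k 0 := hasOrder_const 0

theorem HasOrder.sum {ι : Type*} {s : Finset ι} {F : ι → JetFun} (h : ∀ i ∈ s, HasOrder k (F i)) :
    HasOrder k (∑ i ∈ s, F i) :=
  Finset.sum_induction _ (HasOrder k) (fun _ _ => HasOrder.add) hasOrder_zero h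

theorem hasOrder_coord (h : l ≤ k) : HasOrder k (coord l) := by
  refine ⟨fun z => z.2 ⟨l, by omega⟩, by fun_prop, fun x p => rfl⟩

theorem HasOrder.apply_expNeg (h : HasOrder k F) : HasOrder k (expNeg F) :=
  HasOrder.comp (φ := fun t => Real.exp (-t)) h
    fun _ _ => (Real.contDiff_exp.comp contDiff_neg).contDiffAt

theorem IsSmooth.add (h₁ : IsSmooth F₁) (h₂ : IsSmooth F₂) : IsSmooth (F₁ + F₂) := by
  obtain ⟨k, h₁⟩ := h₁
  obtain ⟨l, h₂⟩ := h₂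
  exact ⟨max k l, (h₁.mono (le_max_left _ _)).add (h₂.mono (le_max_right _ _))⟩

theorem IsSmooth.mul (h₁ : IsSmooth F₁) (h₂ : IsSmooth F₂) : IsSmooth (F₁ * F₂) := by
  obtain ⟨k, h₁⟩ := h₁
  obtain ⟨l, h₂⟩ := h₂
  exact ⟨max k l, (h₁.mono (le_max_left _ _)).mul (h₂.mono (le_max_right _ _))⟩

theorem IsSmooth.smul (h : IsSmooth F) (a : ℝ) : IsSmooth (a • F) := by
  obtain ⟨k, h⟩ := h
  exact ⟨k, h.smul a⟩

theorem isSmooth_zero : IsSmooth 0 := ⟨0, hasOrder_zero⟩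

theorem IsSmooth.sum {ι : Type*} {s : Finset ι} {F : ι → JetFun} (h : ∀ i ∈ s, IsSmooth (F i)) :
    IsSmooth (∑ i ∈ s, F i) :=
  Finset.sum_induction _ IsSmooth (fun _ _ => IsSmooth.add) isSmooth_zero h

theorem isSmooth_coord (l : ℕ) : IsSmooth (coord l) := ⟨l, hasOrder_coord le_rfl⟩

/-! ### Partial derivatives -/

theorem restrict_update {p : ℕ → ℝ} (i : Fin (k + 1)) (t : ℝ) :
    (fun j : Fin (k + 1) => Function.update p i t j) =
      Function.update (fun j : Fin (k + 1) => p j) i t := by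
  ext j
  simp [Function.update_apply, Fin.ext_iff]

/-- `∂_i` as a derivative of a function on a finite-dimensional space. -/
theorem dp_eq_fderiv {G : ℝ × (Fin (k + 1) → ℝ) → ℝ} (hG : ContDiff ℝ ∞ G)
    (hF : ∀ x p, F x p = G (x, fun i => p i)) (i : Fin (k + 1)) (x : ℝ) (p : ℕ → ℝ) :
    dp i F x p = fderiv ℝ G (x, fun j => p j) (0, Pi.single i 1) := by
  simp only [dp, hF, restrict_update]
  have h := (hasDerivAt_const (p i) x).prodMk
    (hasDerivAt_update (fun j : Fin (k + 1) => p j) i (p i))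
  have hp : (x, fun j : Fin (k + 1) => p j) =
      (x, Function.update (fun j : Fin (k + 1) => p j) i (p i)) := by
    rw [Function.update_eq_self i (fun j : Fin (k + 1) => p j)]
  rw [hp]
  exact ((hG.differentiable (by simp) _).hasFDerivAt.comp_hasDerivAt (p i) h).deriv

/-- `∂_x` as a derivative of a function on a finite-dimensional space. -/
theorem dx_eq_fderiv {G : ℝ × (Fin (k + 1) → ℝ) → ℝ} (hG : ContDiff ℝ ∞ G)
    (hF : ∀ x p, F x p = G (x, fun i => p i)) (x : ℝ) (p : ℕ → ℝ) :
    dx F x p = fderiv ℝ G (x, fun j => p j) (1, 0) := by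
  simp only [dx, hF]
  have h := (hasDerivAt_id x).prodMk (hasDerivAt_const x fun j : Fin (k + 1) => p j)
  exact ((hG.differentiable (by simp) _).hasFDerivAt.comp_hasDerivAt x h).deriv

theorem contDiff_fderiv_apply {V : Type*} [NormedAddCommGroup V] [NormedSpace ℝ V] {G : V → ℝ}
    (hG : ContDiff ℝ ∞ G) (v : V) : ContDiff ℝ ∞ fun y => fderiv ℝ G y v :=
  ContDiff.clm_apply (hG.fderiv_right (by simp)) contDiff_const

theorem fderiv_fderiv_apply_comm {V : Type*} [NormedAddCommGroup V] [NormedSpace ℝ V] {G : V → ℝ}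
    (hG : ContDiff ℝ ∞ G) (y v w : V) :
    fderiv ℝ (fun z => fderiv ℝ G z v) y w = fderiv ℝ (fun z => fderiv ℝ G z w) y v := by
  have hd : DifferentiableAt ℝ (fderiv ℝ G) y :=
    (hG.fderiv_right (m := ∞) (by simp)).differentiable (by simp) y
  rw [fderiv_clm_apply hd (differentiableAt_const v),
    fderiv_clm_apply hd (differentiableAt_const w)]
  simpa using ((contDiff_infty.1 hG 2).contDiffAt.isSymmSndFDerivAt (x := y) (by simp)) w v

theorem HasOrder.dp_eq_zero (h : HasOrder k F) (hl : k < l) : dp l F = 0 := by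
  obtain ⟨G, hG, hF⟩ := h
  funext x p
  have (t : ℝ) (i : Fin (k + 1)) : Function.update p l t i = p i := by
    rw [Function.update_of_ne (by omega)]
  simp [dp, hF, this]

theorem HasOrder.apply_dp (h : HasOrder k F) (l : ℕ) : HasOrder k (dp l F) := by
  rcases lt_or_ge k l with hl | hl
  · rw [h.dp_eq_zero hl]
    exact hasOrder_zero
  · obtain ⟨G, hG, hF⟩ := h
    exact ⟨_, contDiff_fderiv_apply hG _, dp_eq_fderiv hG hF ⟨l, by omega⟩⟩

theorem HasOrder.apply_dx (h : HasOrder k F) : HasOrder k (dx F) := by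
  obtain ⟨G, hG, hF⟩ := h
  exact ⟨_, contDiff_fderiv_apply hG _, dx_eq_fderiv hG hF⟩

theorem IsSmooth.apply_dp (h : IsSmooth F) (l : ℕ) : IsSmooth (dp l F) :=
  h.imp fun _ h => h.apply_dp l

theorem IsSmooth.apply_dx (h : IsSmooth F) : IsSmooth (dx F) :=
  h.imp fun _ h => h.apply_dx

theorem IsSmooth.dp_comm (h : IsSmooth F) (k l : ℕ) :
    dp k (dp l F) =
      dp l (dp k F) := by
  obtain ⟨r, h⟩ := h
  obtain ⟨G, hG, hF⟩ := h.mono ((le_max_left r (max k l)))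
  funext x p
  have hk := dp_eq_fderiv hG hF ⟨k, by omega⟩
  have hl := dp_eq_fderiv hG hF ⟨l, by omega⟩
  rw [dp_eq_fderiv (contDiff_fderiv_apply hG _) hl ⟨k, by omega⟩ x p,
    dp_eq_fderiv (contDiff_fderiv_apply hG _) hk ⟨l, by omega⟩ x p,
    fderiv_fderiv_apply_comm hG]

theorem IsSmooth.dp_dx_comm (h : IsSmooth F) (k : ℕ) :
    dp k (dx F) =
      dx (dp k F) := by
  obtain ⟨r, h⟩ := h
  obtain ⟨G, hG, hF⟩ := h.mono ((le_max_left r k))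
  funext x p
  have hk := dp_eq_fderiv hG hF ⟨k, by omega⟩
  rw [dp_eq_fderiv (contDiff_fderiv_apply hG _) (dx_eq_fderiv hG hF) ⟨k, by omega⟩ x p,
    dx_eq_fderiv (contDiff_fderiv_apply hG _) hk x p, fderiv_fderiv_apply_comm hG]

theorem IsSmooth.contDiff_update (h : IsSmooth F) (k : ℕ) (x : ℝ) (p : ℕ → ℝ) :
    ContDiff ℝ ∞ fun t => F x (Function.update p k t) := by
  obtain ⟨r, G, hG, hF⟩ := h
  simp only [hF]
  refine hG.comp (contDiff_const.prodMk (contDiff_pi.2 fun i => ?_))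
  simp only [Function.update_apply]
  split_ifs <;> fun_prop

theorem IsSmooth.contDiff_fst (h : IsSmooth F) (p : ℕ → ℝ) : ContDiff ℝ ∞ fun t => F t p := by
  obtain ⟨r, G, hG, hF⟩ := h
  simp only [hF]
  exact hG.comp (contDiff_id.prodMk contDiff_const)

theorem IsSmooth.hasDerivAt_dp (h : IsSmooth F) (k : ℕ) (x : ℝ) (p : ℕ → ℝ) :
    HasDerivAt (fun t => F x (Function.update p k t)) (dp k F x p) (p k) :=
  ((h.contDiff_update k x p).differentiable (by simp) _).hasDerivAt

theorem IsSmooth.hasDerivAt_dx (h : IsSmooth F) (x : ℝ) (p : ℕ → ℝ) :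
    HasDerivAt (fun t => F t p) (dx F x p) x :=
  ((h.contDiff_fst p).differentiable (by simp) _).hasDerivAt

theorem dp_add (h₁ : IsSmooth F₁) (h₂ : IsSmooth F₂) (k : ℕ) :
    dp k (F₁ + F₂) = dp k F₁ + dp k F₂ :=
  funext fun x => funext fun p => ((h₁.hasDerivAt_dp k x p).add (h₂.hasDerivAt_dp k x p)).deriv

theorem dp_smul (a : ℝ) (k : ℕ) (F : JetFun) : dp k (a • F) = a • dp k F :=
  funext fun _ => funext fun p => deriv_const_mul_field (x := p k) a

theorem dp_mul (h₁ : IsSmooth F₁) (h₂ : IsSmooth F₂) (k : ℕ) :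
    dp k (F₁ * F₂) = dp k F₁ * F₂ + F₁ * dp k F₂ :=
  funext fun x => funext fun p =>
    ((h₁.hasDerivAt_dp k x p).mul (h₂.hasDerivAt_dp k x p)).deriv.trans
      (by simp only [Function.update_eq_self]; rfl)

theorem dp_zero (k : ℕ) : dp k 0 = 0 := by
  funext x p
  simp [dp]

theorem dp_sum {ι : Type*} {s : Finset ι} {F : ι → JetFun} (h : ∀ i ∈ s, IsSmooth (F i)) (k : ℕ) :
    dp k (∑ i ∈ s, F i) = ∑ i ∈ s, dp k (F i) := by
  classical
  induction s using Finset.induction_on with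
  | empty => simp [dp_zero]
  | insert i s hi ih =>
    rw [Finset.sum_insert hi, Finset.sum_insert hi, dp_add (h i (by simp))
      (IsSmooth.sum fun j hj => h j (by simp [hj])), ih fun j hj => h j (by simp [hj])]

theorem dp_coord (k l : ℕ) : dp k (coord l) = fun _ _ => if k = l then 1 else 0 := by
  funext x p
  simp only [dp, coord]
  split_ifs with h
  · subst h; simp
  · simp [Function.update_of_ne (Ne.symm h)]

theorem dx_add (h₁ : IsSmooth F₁) (h₂ : IsSmooth F₂) : dx (F₁ + F₂) = dx F₁ + dx F₂ :=
  funext fun x => funext fun p => ((h₁.hasDerivAt_dx x p).add (h₂.hasDerivAt_dx x p)).deriv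

theorem dx_smul (a : ℝ) (F : JetFun) : dx (a • F) = a • dx F :=
  funext fun x => funext fun _ => deriv_const_mul_field (x := x) a

theorem dx_mul (h₁ : IsSmooth F₁) (h₂ : IsSmooth F₂) : dx (F₁ * F₂) = dx F₁ * F₂ + F₁ * dx F₂ :=
  funext fun x => funext fun p => ((h₁.hasDerivAt_dx x p).mul (h₂.hasDerivAt_dx x p)).deriv

theorem dx_coord (l : ℕ) : dx (coord l) = 0 := by
  funext x p
  simp [dx, coord]

/-- A function whose derivative with respect to `p_k` vanishes does not depend on `p_k`. -/
theorem IsSmooth.eq_update_zero (h : IsSmooth F) (h0 : dp k F = 0) (x : ℝ)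
    (p : ℕ → ℝ) : F x p = F x (Function.update p k 0) := by
  have hc := is_const_of_deriv_eq_zero ((h.contDiff_update k x p).differentiable (by simp))
    (fun t => by
      have := congrFun (congrFun h0 x) (Function.update p k t)
      simpa [dp] using this) (p k) 0
  simpa using hc

theorem HasOrder.of_dp_eq_zero (h : HasOrder (k + 1) F)
    (h0 : dp (k + 1) F = 0) : HasOrder k F := by
  have hu := h.isSmooth.eq_update_zero h0
  obtain ⟨G, hG, hF⟩ := h
  refine ⟨fun z => G (z.1, fun i => if hi : (i : ℕ) < k + 1 then z.2 ⟨i, hi⟩ else 0),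
    hG.comp (contDiff_fst.prodMk (contDiff_pi.2 fun i => ?_)), fun x p => ?_⟩
  · split_ifs <;> fun_prop
  · rw [hu, hF]
    congr 2
    funext i
    by_cases hi : (i : ℕ) < k + 1
    · rw [Function.update_of_ne (by omega)]
      simp [hi]
    · rw [show (i : ℕ) = k + 1 by omega]
      simp

/-! ### Anti-derivatives -/

theorem HasOrder.apply_int1 (h : HasOrder k F) (hl : l ≤ k) : HasOrder k (int1 l F) := by
  obtain ⟨G, hG, hF⟩ := h
  let i : Fin (k + 1) := ⟨l, by omega⟩
  -- The substitution `t = s p_l` makes the domain of integration independent of `p_l`.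
  refine ⟨fun z => z.2 i * ∫ s in (0 : ℝ)..1,
    (fun w : (ℝ × (Fin (k + 1) → ℝ)) × ℝ =>
      G (w.1.1, Function.update w.1.2 i (w.2 * w.1.2 i))) (z, s), ?_, fun x p => ?_⟩
  · have hu : ContDiff ℝ ∞ fun w : (ℝ × (Fin (k + 1) → ℝ)) × ℝ =>
        (w.1.1, Function.update w.1.2 i (w.2 * w.1.2 i)) := by
      refine ContDiff.prodMk (by fun_prop) (contDiff_pi.2 fun j => ?_)
      simp only [Function.update_apply]
      split_ifs <;> fun_prop
    exact ContDiff.mul (by fun_prop) (contDiff_integral_zero_one (hG.comp hu))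
  · have hs := intervalIntegral.smul_integral_comp_mul_right (a := 0) (b := 1)
      (fun t => F x (Function.update p l t)) (p l)
    simp only [smul_eq_mul, zero_mul, one_mul] at hs
    refine hs.symm.trans (congrArg (p l * ·) ?_)
    simp only [hF]
    refine intervalIntegral.integral_congr fun s _ => ?_
    exact congrArg (fun q => G (x, q)) (restrict_update i _)

theorem IsSmooth.dp_int1 (h : IsSmooth F) (k : ℕ) :
    dp k (int1 k F) = F := by
  funext x p
  have hc := (h.contDiff_update k x p).continuous
  have := intervalIntegral.integral_hasDerivAt_right (hc.intervalIntegrable 0 (p k))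
    (hc.stronglyMeasurableAtFilter _ _) hc.continuousAt
  simp only [Function.update_eq_self] at this
  simpa [dp, int1] using this.deriv

theorem int2_eq (k : ℕ) (F : JetFun) : int2 k F = int1 k (int1 k F) := by
  funext x p
  simp [int2, int1]

theorem int2_smul (k : ℕ) (a : ℝ) (F : JetFun) : int2 k (a • F) = a • int2 k F := by
  funext x p
  simp [int2]

theorem HasOrder.apply_int2 (h : HasOrder k F) (hl : l ≤ k) : HasOrder k (int2 l F) := by
  rw [int2_eq]
  exact (h.apply_int1 hl).apply_int1 hl

theorem HasOrder.dp_dp_int2 (h : HasOrder k F) :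
    dp k (dp k (int2 k F)) = F := by
  rw [int2_eq, (h.apply_int1 le_rfl).isSmooth.dp_int1, h.isSmooth.dp_int1]

end FiniteOrder

/-! ### Truncated total derivatives -/

section TotalDerivative

variable {F F₁ F₂ : JetFun} {k l r M M' : ℕ}

theorem D_eq (M : ℕ) (F : JetFun) :
    D M F = dx F + ∑ j ∈ Finset.range M, coord (j + 1) * dp j F := by
  funext x p
  simp [D, coord, Finset.sum_apply]

theorem D_succ (M : ℕ) (F : JetFun) : D (M + 1) F = D M F + coord (M + 1) * dp M F := by
  rw [D_eq, D_eq, Finset.sum_range_succ, add_assoc]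

theorem D_add (M : ℕ) (h₁ : IsSmooth F₁) (h₂ : IsSmooth F₂) :
    D M (F₁ + F₂) = D M F₁ + D M F₂ := by
  simp only [D_eq, dx_add h₁ h₂, dp_add h₁ h₂, mul_add, Finset.sum_add_distrib]
  abel

theorem D_smul (M : ℕ) (a : ℝ) (F : JetFun) : D M (a • F) = a • D M F := by
  simp only [D_eq, dx_smul, dp_smul, mul_smul_comm, smul_add, Finset.smul_sum]

theorem D_zero (M : ℕ) : D M 0 = 0 := by
  simpa using D_smul M 0 0

theorem D_mul (M : ℕ) (h₁ : IsSmooth F₁) (h₂ : IsSmooth F₂) :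
    D M (F₁ * F₂) = D M F₁ * F₂ + F₁ * D M F₂ := by
  simp only [D_eq, dx_mul h₁ h₂, dp_mul h₁ h₂, add_mul, mul_add, Finset.sum_mul, Finset.mul_sum,
    Finset.sum_add_distrib, mul_assoc, mul_left_comm F₁]
  abel

/-- The operator `D_M` treats `p_M` as a constant. -/
theorem D_coord_self (M : ℕ) : D M (coord M) = 0 := by
  rw [D_eq, dx_coord, zero_add]
  refine Finset.sum_eq_zero fun j hj => ?_
  rw [dp_coord]
  funext x p
  simp [(Finset.mem_range.1 hj).ne]

theorem IsSmooth.apply_D (h : IsSmooth F) (M : ℕ) : IsSmooth (D M F) := by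
  rw [D_eq]
  exact h.apply_dx.add (IsSmooth.sum fun j _ => (isSmooth_coord _).mul (h.apply_dp j))

/-- Truncation: `D_M` does not produce variables beyond `p_M`. -/
theorem HasOrder.apply_D_of_le (h : HasOrder r F) (hM : M ≤ r) : HasOrder r (D M F) := by
  rw [D_eq]
  refine h.apply_dx.add (HasOrder.sum fun j hj => (hasOrder_coord ?_).mul (h.apply_dp j))
  have := Finset.mem_range.1 hj
  omega

theorem HasOrder.apply_D (h : HasOrder r F) (M : ℕ) : HasOrder (r + 1) (D M F) := by
  rw [D_eq]
  refine (h.apply_dx.mono (by omega)).add (HasOrder.sum fun j _ => ?_)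
  rcases lt_or_ge r j with hj | hj
  · rw [h.dp_eq_zero hj, mul_zero]
    exact hasOrder_zero
  · exact (hasOrder_coord (by omega)).mul ((h.apply_dp j).mono (by omega))

theorem HasOrder.D_congr (h : HasOrder r F) (hM : r < M) (hM' : r < M') :
    D M F = D M' F := by
  have key : ∀ d, D (r + 1 + d) F = D (r + 1) F := by
    intro d
    induction d with
    | zero => rfl
    | succ d ih => rw [← add_assoc, D_succ, h.dp_eq_zero (by omega), mul_zero, add_zero, ih]
  obtain ⟨d, rfl⟩ := Nat.exists_eq_add_of_le hM
  obtain ⟨d', rfl⟩ := Nat.exists_eq_add_of_le hM'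
  exact (key d).trans (key d').symm

theorem IsSmooth.dp_D (h : IsSmooth F) (k M : ℕ) :
    dp k (D M F) =
      D M (dp k F) +
        ∑ j ∈ Finset.range M, if k = j + 1 then dp j F else 0 := by
  have hs (j : ℕ) : IsSmooth (coord (j + 1) * dp j F) :=
    (isSmooth_coord _).mul (h.apply_dp j)
  rw [D_eq, D_eq, dp_add h.apply_dx (IsSmooth.sum fun j _ => hs j), dp_sum fun j _ => hs j,
    h.dp_dx_comm, add_assoc, ← Finset.sum_add_distrib]
  congr 1
  refine Finset.sum_congr rfl fun j _ => ?_
  rw [dp_mul (isSmooth_coord _) (h.apply_dp j), dp_coord, h.dp_comm, add_comm]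
  congr 1
  funext x p
  split_ifs <;> simp

theorem IsSmooth.dp_succ_D (h : IsSmooth F) (hk : k < M) :
    dp (k + 1) (D M F) =
      D M (dp (k + 1) F) + dp k F := by
  rw [h.dp_D]
  simp [hk]

theorem IsSmooth.dp_zero_D (h : IsSmooth F) (M : ℕ) :
    dp 0 (D M F) =
      D M (dp 0 F) := by
  rw [h.dp_D]
  simp

/-! ### Iterated total derivatives -/

theorem iterate_D_succ (M k : ℕ) (F : JetFun) : (D M)^[k + 1] F = D M ((D M)^[k] F) :=
  Function.iterate_succ_apply' _ _ _

theorem IsSmooth.iterate_D (h : IsSmooth F) (M k : ℕ) :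
    IsSmooth ((D M)^[k] F) := by
  induction k with
  | zero => exact h
  | succ k ih => rw [iterate_D_succ]; exact ih.apply_D M

theorem HasOrder.iterate_D (h : HasOrder r F) (M k : ℕ) :
    HasOrder (r + k) ((D M)^[k] F) := by
  induction k with
  | zero => exact h
  | succ k ih => rw [iterate_D_succ]; exact ih.apply_D M

theorem HasOrder.iterate_D_of_le (h : HasOrder r F) (hM : M ≤ r) (k : ℕ) :
    HasOrder r ((D M)^[k] F) := by
  induction k with
  | zero => exact h
  | succ k ih => rw [iterate_D_succ]; exact ih.apply_D_of_le hM

theorem iterate_D_add (M k : ℕ) (h₁ : IsSmooth F₁) (h₂ : IsSmooth F₂) :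
    (D M)^[k] (F₁ + F₂) = (D M)^[k] F₁ + (D M)^[k] F₂ := by
  induction k with
  | zero => rfl
  | succ k ih => simp only [iterate_D_succ, ih, D_add M (h₁.iterate_D M k) (h₂.iterate_D M k)]

theorem iterate_D_smul (M k : ℕ) (a : ℝ) (F : JetFun) :
    (D M)^[k] (a • F) = a • (D M)^[k] F := by
  induction k with
  | zero => rfl
  | succ k ih => simp only [iterate_D_succ, ih, D_smul]

theorem iterate_D_zero (M k : ℕ) : (D M)^[k] 0 = 0 := by
  simpa using iterate_D_smul M k 0 0

theorem HasOrder.iterate_D_congr (h : HasOrder r F) (hM : r + k ≤ M) (hM' : r + k ≤ M') :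
    (D M)^[k] F = (D M')^[k] F := by
  induction k with
  | zero => rfl
  | succ k ih =>
    rw [iterate_D_succ, iterate_D_succ, ih (by omega) (by omega),
      (h.iterate_D M' k).D_congr (by omega : r + k < M) (by omega : r + k < M')]

/-- For `k ≥ 1` this says that `D^k F` is affine in `p_{r+k}` with coefficient `∂_r F`. -/
theorem HasOrder.dp_iterate_D (h : HasOrder r F) (hM : r + k ≤ M) :
    dp (r + k) ((D M)^[k] F) =
      dp r F := by
  induction k with
  | zero => rfl
  | succ k ih =>
    rw [iterate_D_succ, ← add_assoc, (h.iterate_D M k).isSmooth.dp_succ_D (by omega),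
      ih (by omega), (h.iterate_D M k).dp_eq_zero (by omega), D_zero, zero_add]

/-- The derivative of `D^k F` with respect to its next to highest variable; for `k ≥ 1` the term
`k D ∂_{r+1} F` comes from commuting `∂_{r+k}` past each of the `k` factors `D`. -/
theorem HasOrder.dp_iterate_D_sub (h : HasOrder (r + 1) F) (hM : r + k ≤ M) :
    dp (r + k) ((D M)^[k] F) =
      dp r F +
        (k : ℝ) • D M (dp (r + 1) F) := by
  induction k with
  | zero => simp
  | succ k ih =>
    rw [iterate_D_succ, ← add_assoc, (h.iterate_D M k).isSmooth.dp_succ_D (by omega),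
      ih (by omega), add_right_comm r k 1, h.dp_iterate_D (by omega)]
    push_cast
    rw [add_smul, one_smul]
    abel

theorem HasOrder.iterate_D_succ_eq (h : HasOrder r F) (k : ℕ) :
    (D (r + k + 1))^[k + 1] F =
      (D (r + k))^[k + 1] F +
        coord (r + k + 1) * dp r F := by
  rw [iterate_D_succ, h.iterate_D_congr (by omega : r + k ≤ r + k + 1) (le_refl (r + k)),
    D_succ, h.dp_iterate_D le_rfl, iterate_D_succ]

/-! ### Euler–Lagrange operators -/

theorem E_eq (M k : ℕ) (F : JetFun) :
    E M k F = ∑ j ∈ Finset.range (k + 1), (-1 : ℝ) ^ j • (D M)^[j] (dp j F) := by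
  funext x p
  simp [E, Finset.sum_apply]

theorem E_succ (M k : ℕ) (F : JetFun) :
    E M (k + 1) F = E M k F + (-1 : ℝ) ^ (k + 1) • (D M)^[k + 1] (dp (k + 1) F) := by
  rw [E_eq, E_eq, Finset.sum_range_succ]

theorem E_add (M k : ℕ) (h₁ : IsSmooth F₁) (h₂ : IsSmooth F₂) :
    E M k (F₁ + F₂) = E M k F₁ + E M k F₂ := by
  simp only [E_eq, dp_add h₁ h₂, fun j => iterate_D_add M j (h₁.apply_dp j) (h₂.apply_dp j),
    smul_add, Finset.sum_add_distrib]

theorem E_smul (M k : ℕ) (a : ℝ) (F : JetFun) : E M k (a • F) = a • E M k F := by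
  simp only [E_eq, dp_smul, iterate_D_smul, Finset.smul_sum, smul_comm a]

theorem E_sum (M k : ℕ) {ι : Type*} {s : Finset ι} {F : ι → JetFun}
    (h : ∀ i ∈ s, IsSmooth (F i)) : E M k (∑ i ∈ s, F i) = ∑ i ∈ s, E M k (F i) := by
  classical
  induction s using Finset.induction_on with
  | empty => simpa using E_smul M k 0 0
  | insert i s hi ih =>
    rw [Finset.sum_insert hi, Finset.sum_insert hi, E_add M k (h i (by simp))
      (IsSmooth.sum fun j hj => h j (by simp [hj])), ih fun j hj => h j (by simp [hj])]

theorem HasOrder.apply_E_of_le (h : HasOrder r F) (hM : M ≤ r) (k : ℕ) : HasOrder r (E M k F) := by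
  rw [E_eq]
  exact HasOrder.sum fun j _ => ((h.apply_dp j).iterate_D_of_le hM j).smul _

theorem HasOrder.apply_E (h : HasOrder r F) (M k : ℕ) : HasOrder (r + k) (E M k F) := by
  rw [E_eq]
  refine HasOrder.sum fun j hj => (((h.apply_dp j).iterate_D M j).mono ?_).smul _
  have := Finset.mem_range.1 hj
  omega

/-- For `F` of order `r` the truncation in `E_M^k F` has no effect once `M ≥ r + k`. -/
theorem HasOrder.E_congr (h : HasOrder r F) (hM : r + k ≤ M) (hM' : r + k ≤ M') :
    E M k F = E M' k F := by
  rw [E_eq, E_eq]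
  refine Finset.sum_congr rfl fun j hj => ?_
  have := Finset.mem_range.1 hj
  rw [(h.apply_dp j).iterate_D_congr (by omega : r + j ≤ M) (by omega : r + j ≤ M')]

theorem HasOrder.E_eq_of_le (h : HasOrder r F) (hk : r ≤ k) (hM : r + r ≤ M) :
    E M k F = E (2 * r) r F := by
  rw [h.E_congr (by omega : r + r ≤ 2 * r) hM]
  induction k, hk using Nat.le_induction with
  | base => rfl
  | succ k hk ih => rw [E_succ, ih, h.dp_eq_zero (by omega), iterate_D_zero, smul_zero, add_zero]

/-- The Euler–Lagrange operator annihilates total derivatives. -/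
theorem HasOrder.E_D (h : HasOrder r F) (hM : r < M) :
    E (2 * M) M (D M F) = 0 := by
  rw [h.D_congr hM (by omega : r < 2 * M)]
  -- `∂_{k+1} D = D ∂_{k+1} + ∂_k` makes the alternating sum telescope.
  have key (k : ℕ) (hk : k ≤ M) :
      E (2 * M) k (D (2 * M) F) =
        (-1 : ℝ) ^ k • (D (2 * M))^[k + 1] (dp k F) := by
    induction k with
    | zero => simp [E_eq, h.isSmooth.dp_zero_D]
    | succ k ih =>
      rw [E_succ, ih (by omega), h.isSmooth.dp_succ_D (by omega),
        iterate_D_add _ _ ((h.isSmooth.apply_dp _).apply_D _) (h.isSmooth.apply_dp _),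
        smul_add, ← Function.iterate_succ_apply, pow_succ]
      simp
  rw [key M le_rfl, h.dp_eq_zero hM, iterate_D_zero, smul_zero]

/-- The leading coefficient of the Euler–Lagrange expression. -/
theorem HasOrder.dp_E (h : HasOrder (r + 1) F) :
    dp (2 * (r + 1)) (E (2 * (r + 1)) (r + 1) F) =
      (-1 : ℝ) ^ (r + 1) •
        dp (r + 1) (dp (r + 1) F) := by
  rw [E_succ, dp_add (h.apply_E _ _).isSmooth (((h.isSmooth.apply_dp _).iterate_D _ _).smul _),
    dp_smul, (h.apply_E (2 * (r + 1)) r).dp_eq_zero (by omega), zero_add]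
  have := (h.apply_dp (r + 1)).dp_iterate_D (k := r + 1) (M := 2 * (r + 1)) (by omega)
  rw [← two_mul] at this
  rw [this]

/-- The highest derivative splits off from the Euler–Lagrange expression: what remains is
obtained by setting `p_{2(r+1)} = 0`, that is, by truncating `D` one step earlier. -/
theorem HasOrder.E_eq_top (h : HasOrder (r + 1) F) :
    E (2 * (r + 1)) (r + 1) F =
      E (2 * r + 1) (r + 1) F + (-1 : ℝ) ^ (r + 1) •
        (coord (2 * (r + 1)) *
          dp (r + 1) (dp (r + 1) F)) := by
  have := (h.apply_dp (r + 1)).iterate_D_succ_eq r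
  rw [show r + 1 + r + 1 = 2 * (r + 1) by ring, show r + 1 + r = 2 * r + 1 by ring] at this
  rw [E_succ, E_succ, this, smul_add,
    h.E_congr (by omega : r + 1 + r ≤ 2 * (r + 1)) (by omega : r + 1 + r ≤ 2 * r + 1), add_assoc]

/-- The next to highest derivative splits off from the Euler–Lagrange expression. The bound
`2 ≤ r` makes the coefficient `D ∂_{r+1}² F`, of order `r + 2`, independent of `p_{2r+1}` and of
the truncation. -/
theorem HasOrder.E_eq_top_sub (h : HasOrder (r + 1) F) (hr : 2 ≤ r) :
    E (2 * r + 1) (r + 1) F =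
      E (2 * r) (r + 1) F + (-1 : ℝ) ^ (r + 1) •
        (coord (2 * r + 1) * ((r + 1 : ℝ) • D (r + 2)
          (dp (r + 1) (dp (r + 1) F)))) := by
  obtain ⟨s, rfl⟩ : ∃ s, r = s + 1 := ⟨r - 1, by omega⟩
  set g := dp (s + 1 + 1) F with hg
  have hgo : HasOrder (s + 1 + 1) g := h.apply_dp _
  have huo := hgo.apply_dp (s + 1 + 1)
  set u := dp (s + 1 + 1) g with hu
  -- the term with `s + 1` total derivatives
  have h1 : (D (2 * (s + 1) + 1))^[s + 1]
        (dp (s + 1) F) =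
      (D (2 * (s + 1)))^[s + 1] (dp (s + 1) F) +
        coord (2 * (s + 1) + 1) * dp (s + 1) g := by
    have := (h.apply_dp (s + 1)).iterate_D_succ_eq s
    rw [show s + 1 + 1 + s = 2 * (s + 1) by ring] at this
    rw [this, h.isSmooth.dp_comm]
  -- the term with `s + 2` total derivatives
  have h2 : (D (2 * (s + 1) + 1))^[s + 1] g =
      (D (2 * (s + 1)))^[s + 1] g + coord (2 * (s + 1) + 1) * u := by
    have := hgo.iterate_D_succ_eq s
    rwa [show s + 1 + 1 + s = 2 * (s + 1) by ring] at this
  have h3 : dp (2 * (s + 1)) ((D (2 * (s + 1)))^[s + 1] g) =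
      dp (s + 1) g + ((s + 1 : ℕ) : ℝ) • D (s + 1 + 2) u := by
    have := hgo.dp_iterate_D_sub (k := s + 1) (M := 2 * (s + 1)) (by omega)
    rw [← two_mul] at this
    rw [this, huo.D_congr (by omega : s + 1 + 1 < 2 * (s + 1)) (by omega : s + 1 + 1 < s + 1 + 2)]
  have h4 : (D (2 * (s + 1) + 1))^[s + 1 + 1] g =
      (D (2 * (s + 1)))^[s + 1 + 1] g + coord (2 * (s + 1) + 1) *
        (dp (s + 1) g +
          ((s + 1 : ℕ) : ℝ) • D (s + 1 + 2) u) +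
        coord (2 * (s + 1) + 1) * D (s + 1 + 2) u := by
    rw [iterate_D_succ, h2, D_add _ (hgo.isSmooth.iterate_D _ _)
      ((isSmooth_coord _).mul huo.isSmooth), D_mul _ (isSmooth_coord _) huo.isSmooth,
      D_coord_self, zero_mul, zero_add, D_succ, h3, ← iterate_D_succ,
      huo.D_congr (by omega : s + 1 + 1 < 2 * (s + 1) + 1) (by omega : s + 1 + 1 < s + 1 + 2)]
  rw [E_succ, E_succ, E_succ (2 * (s + 1)) (s + 1), E_succ (2 * (s + 1)) s, h4, h1,
    h.E_congr (by omega : s + 1 + 1 + s ≤ 2 * (s + 1) + 1)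
      (by omega : s + 1 + 1 + s ≤ 2 * (s + 1))]
  funext x p
  simp only [Pi.add_apply, Pi.smul_apply, Pi.mul_apply, smul_eq_mul, pow_succ]
  push_cast
  ring

end TotalDerivative

/-! ### The Lagrangians of the normal form are solutions -/

section NormalForm

variable {F L N R f ρ : JetFun} {c : ℕ → JetFun} {k m n r M : ℕ}

theorem IsSmooth.D_expNeg (h : IsSmooth R) (M : ℕ) : D M (expNeg R) = -(expNeg R * D M R) := by
  have hp (j : ℕ) : dp j (expNeg R) = -(expNeg R * dp j R) := by
    funext x p
    simpa [expNeg, dp] using (h.hasDerivAt_dp j x p).neg.exp.deriv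
  have hx : dx (expNeg R) = -(expNeg R * dx R) := by
    funext x p
    simpa [expNeg, dx] using (h.hasDerivAt_dx x p).neg.exp.deriv
  simp only [D_eq, hp, hx, mul_add, neg_add, Finset.mul_sum, Finset.sum_neg_distrib, mul_neg,
    mul_left_comm]

theorem formL_eq (n m : ℕ) (R : JetFun) (c : ℕ → JetFun) (N : JetFun) :
    formL n m R c N = (-1 : ℝ) ^ n • int2 n (expNeg R) +
      ∑ l ∈ Finset.Icc 1 (n - 1), (-1 : ℝ) ^ l • int2 l (c l) + int1 0 (c 0) + D m N := by
  funext x p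
  simp [formL, Finset.sum_apply]

theorem formF_eq (n : ℕ) (R : JetFun) (c : ℕ → JetFun) :
    formF n R c = (n : ℝ) • D (n + 1) R * coord (2 * n - 1) - (fun x p => Real.exp (R x p)) *
      ((-1 : ℝ) ^ n • E (2 * n - 2) n (int2 n (expNeg R)) +
        ∑ l ∈ Finset.Icc 1 (n - 1),
          (c l * coord (2 * l) + (-1 : ℝ) ^ l • E (2 * l - 1) l (int2 l (c l))) + c 0) := by
  funext x p
  simp [formF, coord, Finset.sum_apply, mul_assoc]

theorem expNeg_mul_exp (R : JetFun) : expNeg R * (fun x p => Real.exp (R x p)) = 1 := by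
  funext x p
  simp [expNeg, ← Real.exp_add]

theorem HasOrder.apply_formF (hn : 3 ≤ n) (hR : HasOrder n R) (hc : ∀ k < n, HasOrder k (c k)) :
    HasOrder (2 * n - 1) (formF n R c) := by
  rw [formF_eq]
  refine ((((hR.apply_D _).mono (by omega)).smul _).mul (hasOrder_coord le_rfl)).sub
    (((hR.comp fun _ _ => Real.contDiff_exp.contDiffAt).mono (by omega)).mul
      ((HasOrder.add ?_ (HasOrder.sum fun l hl => ?_)).add ((hc 0 (by omega)).mono (by omega))))
  · exact (((hR.apply_expNeg.apply_int2 le_rfl).mono (by omega : n ≤ 2 * n - 1)).apply_E_of_le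
      (by omega) _).smul _
  · obtain ⟨h1, h2⟩ := Finset.mem_Icc.1 hl
    have h := hc l (by omega)
    exact ((h.mono (by omega)).mul (hasOrder_coord (by omega))).add
      ((((h.apply_int2 le_rfl).mono (by omega : l ≤ 2 * n - 1)).apply_E_of_le
        (by omega) _).smul _)

theorem HasOrder.apply_formL (hn : 3 ≤ n) (hnm : n ≤ m) (hR : HasOrder n R)
    (hc : ∀ k < n, HasOrder k (c k)) (hN : HasOrder (m - 1) N) :
    HasOrder m (formL n m R c N) := by
  rw [formL_eq]
  refine ((HasOrder.add (((hR.apply_expNeg.apply_int2 le_rfl).smul _).mono hnm)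
    (HasOrder.sum fun l hl => ?_)).add
    (((hc 0 (by omega)).apply_int1 le_rfl).mono (by omega))).add ?_
  · have := Finset.mem_Icc.1 hl
    exact (((hc l (by omega)).apply_int2 le_rfl).smul _).mono (by omega)
  · exact (hN.apply_D m).mono (by omega)

/-- The Euler–Lagrange expression of a term `∫^{p_l}∫ F` with `F` of order `l ≥ 1`. -/
theorem HasOrder.E_int2 (h : HasOrder (r + 1) F) (hr : r + 1 ≤ m) :
    E (2 * m) m (int2 (r + 1) F) = E (2 * r + 1) (r + 1) (int2 (r + 1) F) +
      (-1 : ℝ) ^ (r + 1) • (coord (2 * (r + 1)) * F) := by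
  have hi := h.apply_int2 le_rfl
  rw [hi.E_eq_of_le hr (by omega), hi.E_eq_top, h.dp_dp_int2]

theorem HasOrder.E_int1_zero (h : HasOrder 0 F) (m : ℕ) : E (2 * m) m (int1 0 F) = F := by
  rw [(h.apply_int1 le_rfl).E_eq_of_le (Nat.zero_le m) (by omega)]
  simp [E_eq, h.isSmooth.dp_int1]

theorem neg_one_pow_smul_smul (k : ℕ) (F : JetFun) : (-1 : ℝ) ^ k • (-1 : ℝ) ^ k • F = F := by
  rw [smul_smul, ← mul_pow]
  simp

theorem E_formL (hn : 3 ≤ n) (hnm : n ≤ m) (hR : HasOrder n R)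
    (hc : ∀ k < n, HasOrder k (c k)) (hN : HasOrder (m - 1) N) :
    E (2 * m) m (formL n m R c N) = expNeg R * (coord (2 * n) - formF n R c) := by
  have hint := hR.apply_expNeg.apply_int2 le_rfl
  have hintc (l : ℕ) (hl : l ∈ Finset.Icc 1 (n - 1)) : IsSmooth ((-1 : ℝ) ^ l • int2 l (c l)) := by
    have := Finset.mem_Icc.1 hl
    exact (((hc l (by omega)).apply_int2 le_rfl).smul _).isSmooth
  have h0 := hc 0 (by omega)
  have hs := IsSmooth.sum hintc
  have hi := hint.isSmooth.smul ((-1) ^ n)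
  have h0s := (h0.apply_int1 le_rfl).isSmooth
  have hsum : ∑ l ∈ Finset.Icc 1 (n - 1), E (2 * m) m ((-1 : ℝ) ^ l • int2 l (c l)) =
      ∑ l ∈ Finset.Icc 1 (n - 1),
        (c l * coord (2 * l) + (-1 : ℝ) ^ l • E (2 * l - 1) l (int2 l (c l))) := by
    refine Finset.sum_congr rfl fun l hl => ?_
    obtain ⟨h1, h2⟩ := Finset.mem_Icc.1 hl
    obtain ⟨r, rfl⟩ : ∃ r, l = r + 1 := ⟨l - 1, by omega⟩
    rw [E_smul, (hc (r + 1) (by omega)).E_int2 (by omega), smul_add, neg_one_pow_smul_smul,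
      add_comm, mul_comm, show 2 * (r + 1) - 1 = 2 * r + 1 by omega]
  have htop : E (2 * m) m ((-1 : ℝ) ^ n • int2 n (expNeg R)) =
      (-1 : ℝ) ^ n • E (2 * n - 2) n (int2 n (expNeg R)) +
        coord (2 * n - 1) * ((n : ℝ) • D (n + 1) (expNeg R)) + coord (2 * n) * expNeg R := by
    obtain ⟨r, rfl⟩ : ∃ r, n = r + 1 := ⟨n - 1, by omega⟩
    rw [E_smul, hR.apply_expNeg.E_int2 hnm, hint.E_eq_top_sub (by omega), smul_add, smul_add,
      neg_one_pow_smul_smul, neg_one_pow_smul_smul, hR.apply_expNeg.dp_dp_int2,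
      show 2 * (r + 1) - 2 = 2 * r by omega, show 2 * (r + 1) - 1 = 2 * r + 1 by omega]
    push_cast
    rfl
  rw [formL_eq, E_add _ _ ((hi.add hs).add h0s) (hN.isSmooth.apply_D m),
    hN.E_D (by omega), E_add _ _ (hi.add hs) h0s, E_add _ _ hi hs, E_sum _ _ hintc, hsum, htop,
    h0.E_int1_zero, formF_eq, hR.isSmooth.D_expNeg]
  set A := E (2 * n - 2) n (int2 n (expNeg R))
  set B := ∑ l ∈ Finset.Icc 1 (n - 1),
    (c l * coord (2 * l) + (-1 : ℝ) ^ l • E (2 * l - 1) l (int2 l (c l)))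
  funext x p
  have hexp := congrFun (congrFun (expNeg_mul_exp R) x) p
  simp only [Pi.add_apply, Pi.sub_apply, Pi.mul_apply, Pi.smul_apply, Pi.neg_apply, smul_eq_mul,
    Pi.zero_apply, Pi.one_apply] at hexp ⊢
  linear_combination (-((-1 : ℝ) ^ n * A x p + B x p + c 0 x p)) * hexp

theorem solves_iff : Solves n m ρ f L ↔ E (2 * m) m L = ρ * (coord (2 * n) - f) :=
  ⟨fun h => funext fun x => funext fun p => (h x p).symm,
    fun h x p => (congrFun (congrFun h x) p).symm⟩

/-! ### Reduction of Lagrangians to the normal form -/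

/-- A Lagrangian that is affine in its highest derivative is equivalent to one of lower order:
if `A` is the coefficient of `p_{k+1}`, subtract the total derivative of `∫^{p_k} A`. -/
theorem HasOrder.exists_eq_add_D (h : HasOrder (k + 1) L) (h0 : dp (k + 1) (dp (k + 1) L) = 0) :
    ∃ L' N : JetFun, HasOrder k L' ∧ HasOrder k N ∧ ∀ M, k < M → L = L' + D M N := by
  have hA : HasOrder k (dp (k + 1) L) := (h.apply_dp _).of_dp_eq_zero h0
  have hN : HasOrder k (int1 k (dp (k + 1) L)) := hA.apply_int1 le_rfl
  have hD := hN.apply_D (k + 1)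
  refine ⟨L - D (k + 1) (int1 k (dp (k + 1) L)), int1 k (dp (k + 1) L),
    (h.sub hD).of_dp_eq_zero ?_, hN, fun M hM => ?_⟩
  · rw [sub_eq_add_neg, ← neg_one_smul ℝ, dp_add h.isSmooth (hD.isSmooth.smul _), dp_smul,
      hN.isSmooth.dp_succ_D (by omega), hN.dp_eq_zero (by omega), D_zero, zero_add,
      hA.isSmooth.dp_int1, neg_one_smul, add_neg_cancel]
  · rw [hN.D_congr hM (by omega : k < k + 1), sub_add_cancel]

/-- Subtracting `∫^{p_k}∫ ∂_k² L` makes a Lagrangian affine in its highest derivative. -/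
theorem HasOrder.dp_dp_sub_int2 (h : HasOrder k L) :
    dp k (dp k (L - int2 k (dp k (dp k L)))) = 0 := by
  have hL := (h.apply_dp k).apply_dp k
  have hi := (hL.apply_int2 le_rfl).isSmooth
  rw [sub_eq_add_neg, ← neg_one_smul ℝ, dp_add h.isSmooth (hi.smul _), dp_smul,
    dp_add (h.isSmooth.apply_dp k) ((hi.apply_dp k).smul _), dp_smul, hL.dp_dp_int2, neg_one_smul,
    add_neg_cancel]

/-- A function of `x` alone is a total derivative. -/
theorem HasOrder.exists_eq_D_of_dp_zero (h : HasOrder 0 F) (h0 : dp 0 F = 0) :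
    ∃ N : JetFun, HasOrder 0 N ∧ ∀ M, F = D M N := by
  have hu := h.isSmooth.eq_update_zero h0
  have hF (x : ℝ) (p : ℕ → ℝ) : F x p = F x 0 := by
    obtain ⟨G, hG, hF⟩ := h
    rw [hu x p, hF, hF]
    congr 2
    funext i
    simp
  have hg : ContDiff ℝ ∞ fun x => F x 0 := h.isSmooth.contDiff_fst 0
  have hd (x : ℝ) : HasDerivAt (fun x => ∫ t in (0 : ℝ)..x, F t 0) (F x 0) x :=
    intervalIntegral.integral_hasDerivAt_right (hg.continuous.intervalIntegrable _ _)
      (hg.continuous.stronglyMeasurableAtFilter _ _) hg.continuous.continuousAt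
  refine ⟨fun x _ => ∫ t in (0 : ℝ)..x, F t 0,
    ⟨fun z => ∫ t in (0 : ℝ)..z.1, F t 0,
      ContDiff.comp (g := fun x => ∫ t in (0 : ℝ)..x, F t 0) ?_ contDiff_fst, fun _ _ => rfl⟩,
    fun M => ?_⟩
  · rw [contDiff_infty_iff_deriv]
    refine ⟨fun x => (hd x).differentiableAt, ?_⟩
    rwa [show deriv (fun x => ∫ t in (0 : ℝ)..x, F t 0) = fun x => F x 0 from
      funext fun x => (hd x).deriv]
  · funext x p
    simp [D, dp, dx, (hd x).deriv, hF x p]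

/-- Every Lagrangian of order `k` is, up to a total derivative, a sum of double anti-derivatives
`∫^{p_l}∫ c_l` with `c_l` of order `l` and a single anti-derivative `∫^{p₀} c₀`. The function `N`
does not depend on the truncation `M` of the total derivative. -/
theorem HasOrder.exists_normal_form (h : HasOrder k L) :
    ∃ (c : ℕ → JetFun) (N : JetFun), (∀ l ≤ k, HasOrder l (c l)) ∧ HasOrder (k - 1) N ∧
      ∀ M, k ≤ M → 0 < M →
        L = ∑ l ∈ Finset.Icc 1 k, (-1 : ℝ) ^ l • int2 l (c l) + int1 0 (c 0) + D M N := by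
  induction k generalizing L with
  | zero =>
    have hi := (h.apply_dp 0).apply_int1 le_rfl
    obtain ⟨N, hN, hLN⟩ := (h.sub hi).exists_eq_D_of_dp_zero (by
      rw [sub_eq_add_neg, ← neg_one_smul ℝ, dp_add h.isSmooth (hi.isSmooth.smul _), dp_smul,
        (h.apply_dp 0).isSmooth.dp_int1, neg_one_smul, add_neg_cancel])
    refine ⟨fun _ => dp 0 L, N, fun l hl => ?_, hN, fun M _ _ => ?_⟩
    · rw [Nat.le_zero.1 hl]
      exact h.apply_dp 0
    · rw [← hLN]
      simp
  | succ k ih =>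
    have hc := (h.apply_dp (k + 1)).apply_dp (k + 1)
    obtain ⟨L', N₁, hL', hN₁, hLN⟩ :=
      (h.sub (hc.apply_int2 le_rfl)).exists_eq_add_D h.dp_dp_sub_int2
    obtain ⟨c, N₂, hcl, hN₂, hLc⟩ := ih hL'
    refine ⟨Function.update c (k + 1) ((-1 : ℝ) ^ (k + 1) • dp (k + 1) (dp (k + 1) L)), N₁ + N₂,
      fun l hl => ?_, hN₁.add (hN₂.mono (by omega)), fun M hM hM' => ?_⟩
    · rcases eq_or_ne l (k + 1) with rfl | hne
      · rw [Function.update_self]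
        exact hc.smul _
      · rw [Function.update_of_ne hne]
        exact hcl l (by omega)
    · have hsum : ∑ l ∈ Finset.Icc 1 k, (-1 : ℝ) ^ l • int2 l (Function.update c (k + 1)
          ((-1 : ℝ) ^ (k + 1) • dp (k + 1) (dp (k + 1) L)) l) =
          ∑ l ∈ Finset.Icc 1 k, (-1 : ℝ) ^ l • int2 l (c l) := by
        refine Finset.sum_congr rfl fun l hl => ?_
        have := Finset.mem_Icc.1 hl
        rw [Function.update_of_ne (by omega)]
      rw [Finset.sum_Icc_succ_top (by omega), hsum, Function.update_self, int2_smul,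
        neg_one_pow_smul_smul, Function.update_of_ne (by omega), D_add M hN₁.isSmooth hN₂.isSmooth]
      have h1 := hLN M (by omega)
      rw [hLc M (by omega) hM'] at h1
      refine (sub_eq_iff_eq_add.1 h1).trans ?_
      abel

/-- If the Euler–Lagrange expression of `L` has order `2n`, then `L` is equivalent to a
Lagrangian of order `n`. -/
theorem HasOrder.exists_eq_add_D_of_E (hnk : n ≤ k) (h : HasOrder k L)
    (hE : HasOrder (2 * n) (E (2 * k) k L)) :
    ∃ L' N : JetFun, HasOrder n L' ∧ HasOrder (k - 1) N ∧ ∀ M, k ≤ M → L = L' + D M N := by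
  induction k, hnk using Nat.le_induction generalizing L with
  | base => exact ⟨L, 0, h, hasOrder_zero, fun M _ => by rw [D_zero, add_zero]⟩
  | succ k hk ih =>
    have h0 : dp (k + 1) (dp (k + 1) L) = 0 := by
      have := h.dp_E
      rw [hE.dp_eq_zero (by omega)] at this
      exact (smul_eq_zero.1 this.symm).resolve_left (by simp)
    obtain ⟨L₁, N₁, hL₁, hN₁, hLN₁⟩ := h.exists_eq_add_D h0
    have hE₁ : E (2 * k) k L₁ = E (2 * (k + 1)) (k + 1) L := by
      rw [hLN₁ (k + 1) (by omega), E_add _ _ hL₁.isSmooth (hN₁.isSmooth.apply_D _),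
        hN₁.E_D (by omega), add_zero, hL₁.E_eq_of_le (k := k + 1) (by omega) (by omega)]
    obtain ⟨L', N₂, hL', hN₂, hLN₂⟩ := ih hL₁ (hE₁ ▸ hE)
    refine ⟨L', N₁ + N₂, hL', hN₁.add (hN₂.mono (by omega)), fun M hM => ?_⟩
    rw [hLN₁ M (by omega), hLN₂ M (by omega), D_add M hN₁.isSmooth hN₂.isSmooth]
    abel

theorem exists_form_of_solves (hn : 3 ≤ n) (hnm : n ≤ m) (hf : HasOrder (2 * n - 1) f)
    (hρ : HasOrder (2 * n - 1) ρ) (hL : HasOrder m L) (hpos : ∀ x p, 0 < ρ x p)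
    (hsol : Solves n m ρ f L) :
    ∃ (R : JetFun) (c : ℕ → JetFun) (N : JetFun),
      HasOrder n R ∧ (∀ k < n, HasOrder k (c k)) ∧ HasOrder (m - 1) N ∧
      f = formF n R c ∧ ρ = expNeg R ∧ L = formL n m R c N := by
  have hE := solves_iff.1 hsol
  have hEo : HasOrder (2 * n) (E (2 * m) m L) := by
    rw [hE]
    exact (hρ.mono (by omega)).mul ((hasOrder_coord le_rfl).sub (hf.mono (by omega)))
  obtain ⟨L₁, N₁, hL₁, hN₁, hLN₁⟩ := hL.exists_eq_add_D_of_E hnm hEo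
  have hE₁ : E (2 * n) n L₁ = ρ * (coord (2 * n) - f) := by
    rw [← hE, hLN₁ m le_rfl, E_add _ _ hL₁.isSmooth (hN₁.isSmooth.apply_D _), hN₁.E_D (by omega),
      add_zero, hL₁.E_eq_of_le hnm (by omega)]
  -- comparing coefficients of `p_{2n}` identifies the multiplier
  have hρL : (-1 : ℝ) ^ n • dp n (dp n L₁) = ρ := by
    obtain ⟨r, rfl⟩ : ∃ r, n = r + 1 := ⟨n - 1, by omega⟩
    rw [← hL₁.dp_E, hE₁, dp_mul hρ.isSmooth ((hasOrder_coord le_rfl).sub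
      (hf.mono (by omega : _ ≤ 2 * (r + 1)))).isSmooth, hρ.dp_eq_zero (by omega), zero_mul,
      zero_add, sub_eq_add_neg, ← neg_one_smul ℝ, dp_add (isSmooth_coord _) (hf.smul _).isSmooth,
      dp_smul, hf.dp_eq_zero (by omega), dp_coord]
    funext x p
    simp
  have hρn : HasOrder n ρ := hρL ▸ ((hL₁.apply_dp n).apply_dp n).smul _
  let R : JetFun := fun x p => -Real.log (ρ x p)
  have hR : HasOrder n R := HasOrder.comp (φ := fun t => -Real.log t) hρn
    fun x p => (Real.contDiffAt_log.2 (hpos x p).ne').neg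
  have hρR : ρ = expNeg R := by
    funext x p
    simp [R, expNeg, Real.exp_log (hpos x p)]
  have hρL' : dp n (dp n L₁) = (-1 : ℝ) ^ n • ρ := by
    rw [← hρL, neg_one_pow_smul_smul]
  have h0 := hL₁.dp_dp_sub_int2
  rw [hρL', int2_smul] at h0
  have hL₂ := hL₁.sub ((hρn.apply_int2 le_rfl).smul ((-1) ^ n))
  obtain ⟨L₃, N₂, hL₃, hN₂, hLN₂⟩ : ∃ L' N : JetFun, HasOrder (n - 1) L' ∧ HasOrder (n - 1) N ∧
      ∀ M, n - 1 < M → L₁ - (-1 : ℝ) ^ n • int2 n ρ = L' + D M N := by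
    obtain ⟨r, rfl⟩ : ∃ r, n = r + 1 := ⟨n - 1, by omega⟩
    exact hL₂.exists_eq_add_D h0
  obtain ⟨c, N₃, hc, hN₃, hLc⟩ := hL₃.exists_normal_form
  have hc' : ∀ k < n, HasOrder k (c k) := fun k hk => hc k (by omega)
  have hN : HasOrder (m - 1) (N₁ + N₂ + N₃) :=
    (hN₁.add (hN₂.mono (by omega))).add (hN₃.mono (by omega))
  have hLform : L = formL n m R c (N₁ + N₂ + N₃) := by
    rw [formL_eq, ← hρR, D_add _ (hN₁.isSmooth.add hN₂.isSmooth) hN₃.isSmooth,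
      D_add _ hN₁.isSmooth hN₂.isSmooth, hLN₁ m le_rfl,
      sub_eq_iff_eq_add.1 (hLN₂ m (by omega)), hLc m (by omega) (by omega)]
    abel
  refine ⟨R, c, N₁ + N₂ + N₃, hR, hc', hN, ?_, hρR, hLform⟩
  have hEq := E_formL hn hnm hR hc' hN
  rw [← hLform, hE, ← hρR] at hEq
  funext x p
  have := congrFun (congrFun hEq x) p
  simpa [(hpos x p).ne'] using this

end NormalForm

end MultiplierProblem

theorem theoremD (n m : ℕ) (hn : 3 ≤ n) (hnm : n ≤ m) :
    -- every solution has the stated form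
    (∀ f ρ L : JetFun, HasOrder (2 * n - 1) f → HasOrder (2 * n - 1) ρ → HasOrder m L →
      (∀ x p, 0 < ρ x p) → Solves n m ρ f L →
      ∃ (R : JetFun) (c : ℕ → JetFun) (N : JetFun),
        HasOrder n R ∧ (∀ k < n, HasOrder k (c k)) ∧ HasOrder (m - 1) N ∧
        f = formF n R c ∧ ρ = expNeg R ∧ L = formL n m R c N) ∧
    -- conversely, every choice of the free functions gives a solution
    (∀ (R : JetFun) (c : ℕ → JetFun) (N : JetFun),
      HasOrder n R → (∀ k < n, HasOrder k (c k)) → HasOrder (m - 1) N →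
      HasOrder (2 * n - 1) (formF n R c) ∧ HasOrder n (expNeg R) ∧
        HasOrder m (formL n m R c N) ∧ (∀ x p, 0 < expNeg R x p) ∧
        Solves n m (expNeg R) (formF n R c) (formL n m R c N)) ∧
    -- no new equations (or multipliers) arise from Lagrangians of order `m` instead of `n`
    (∀ f ρ : JetFun, HasOrder (2 * n - 1) f → HasOrder (2 * n - 1) ρ → (∀ x p, 0 < ρ x p) →
      ((∃ L : JetFun, HasOrder m L ∧ Solves n m ρ f L) ↔
        (HasOrder n ρ ∧ ∃ L : JetFun, HasOrder n L ∧ Solves n n ρ f L))) := by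
  refine ⟨fun f ρ L hf hρ hL hpos hsol => exists_form_of_solves hn hnm hf hρ hL hpos hsol,
    fun R c N hR hc hN => ⟨hR.apply_formF hn hc, hR.apply_expNeg, hR.apply_formL hn hnm hc hN,
      fun x p => Real.exp_pos _, solves_iff.2 (E_formL hn hnm hR hc hN)⟩,
    fun f ρ hf hρ hpos => ⟨?_, ?_⟩⟩
  · rintro ⟨L, hL, hsol⟩
    obtain ⟨R, c, N, hR, hc, -, rfl, rfl, -⟩ :=
      exists_form_of_solves hn hnm hf hρ hL hpos hsol
    exact ⟨hR.apply_expNeg, formL n n R c 0, hR.apply_formL hn le_rfl hc hasOrder_zero,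
      solves_iff.2 (E_formL hn le_rfl hR hc hasOrder_zero)⟩
  · rintro ⟨-, L, hL, hsol⟩
    refine ⟨L, hL.mono hnm, solves_iff.2 ?_⟩
    rw [hL.E_eq_of_le hnm (by omega)]
    exact solves_iff.1 hsol
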